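/- Let $W(2,2)$ be the complex Lie algebra with basis $\{L_m, H_m, c \mid m\in\mathbb{Z}\}$ and Lie brackets $$[L_m,L_n]=(m-n)L_{m+n}+\frac{m^3-m}{12}\delta_{m+n,0}\,c,\qquad [L_m,H_n]=(m-n)H_{m+n}+\frac{m^3-m}{12}\delta_{m+n,0}\,c,$$ $$[H_m,H_n]=0,\qquad [W(2,2),c]=0$$ for all $m,n\in\mathbb{Z}$, and let $\omega:W(2,2)\to W(2,2)$ be the linear map defined by $\omega(L_m)=H_m$ and $\omega(H_m)=\omega(c)=0$ for all $m\in\mathbb{Z}$. Theorem. A linear map $\varphi: W(2,2)\to W(2,2)$ is commuting, that is, $[\varphi(x),x]=0$ for all $x\in W(2,2)$, if and only if there are complex numbers $\lambda,\mu$ and a linear functional $\sigma: W(2,2)\to\mathbb{C}$ such that $$\varphi(x)=\lambda x+\mu\,\omega(x)+\sigma(x)c\qquad\text{for all } x\in W(2,2).$$ -/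

import Mathlib

/-- Index set of the standard basis `{L_m, H_m, c | m ∈ ℤ}` of the W-algebra `W(2,2)`. -/
inductive W22.Gen : Type
  | L (m : ℤ) : W22.Gen
  | H (m : ℤ) : W22.Gen
  | c : W22.Gen

/-- The complex vector space underlying `W(2,2)`, with basis indexed by `W22.Gen`. -/
def W22 : Type := W22.Gen →₀ ℂ

namespace W22

noncomputable section

instance instAddCommGroup : AddCommGroup W22 := inferInstanceAs (AddCommGroup (Gen →₀ ℂ))

instance instModule : Module ℂ W22 := inferInstanceAs (Module ℂ (Gen →₀ ℂ))

/-- The standard basis of `W(2,2)`. -/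
def basis : Module.Basis Gen ℂ W22 := Module.Basis.ofRepr (LinearEquiv.refl ℂ (Gen →₀ ℂ))

/-- The basis element `L_m`. -/
def L (m : ℤ) : W22 := basis (Gen.L m)

/-- The basis element `H_m`. -/
def H (m : ℤ) : W22 := basis (Gen.H m)

/-- The central basis element `c`. -/
def c : W22 := basis Gen.c

/-- The central term `(m³ - m) / 12 · δ_{m+n,0} · c`. -/
def centralTerm (m n : ℤ) : W22 :=
  if m + n = 0 then (((m : ℂ) ^ 3 - (m : ℂ)) / 12) • c else 0

/-- The Lie bracket of `W(2,2)` on basis elements. -/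
def bracketGen : Gen → Gen → W22
  | Gen.L m, Gen.L n => ((m : ℂ) - (n : ℂ)) • L (m + n) + centralTerm m n
  | Gen.L m, Gen.H n => ((m : ℂ) - (n : ℂ)) • H (m + n) + centralTerm m n
  | Gen.H m, Gen.L n => -(((n : ℂ) - (m : ℂ)) • H (n + m) + centralTerm n m)
  | Gen.H _, Gen.H _ => 0
  | Gen.L _, Gen.c => 0
  | Gen.H _, Gen.c => 0
  | Gen.c, Gen.L _ => 0
  | Gen.c, Gen.H _ => 0
  | Gen.c, Gen.c => 0

/-- The bilinear extension of `bracketGen`. -/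
def bracketBilin : W22 →ₗ[ℂ] W22 →ₗ[ℂ] W22 :=
  basis.constr ℂ fun i => basis.constr ℂ (bracketGen i)

theorem bracketBilin_basis (i j : Gen) :
    bracketBilin (basis i) (basis j) = bracketGen i j := by
  simp [bracketBilin]

theorem centralTerm_swap (m n : ℤ) : centralTerm n m = -centralTerm m n := by
  unfold centralTerm
  by_cases h : m + n = 0
  · obtain rfl : n = -m := by omega
    simp only [neg_add_cancel, add_neg_cancel, if_true, ← neg_smul]
    congr 1
    push_cast
    ring
  · rw [if_neg h, if_neg (by omega), neg_zero]

theorem bracketGen_swap (i j : Gen) : bracketGen j i = -bracketGen i j := by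
  cases i with
  | L m => cases j with
    | L n =>
      simp only [bracketGen]
      rw [centralTerm_swap m n, add_comm n m]
      module
    | H n => simp only [bracketGen]
    | c => simp [bracketGen]
  | H m => cases j with
    | L n => simp only [bracketGen, neg_neg]
    | H n => simp [bracketGen]
    | c => simp [bracketGen]
  | c => cases j <;> simp [bracketGen]

theorem bracketBilin_swap (x y : W22) : bracketBilin y x = -bracketBilin x y := by
  have h : bracketBilin.flip = -bracketBilin := by
    refine basis.ext fun i => basis.ext fun j => ?_
    simp [bracketBilin_basis, bracketGen_swap i j]
  exact LinearMap.congr_fun (LinearMap.congr_fun h x) y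

theorem bracketBilin_self (x : W22) : bracketBilin x x = 0 := by
  have h : (2 : ℂ) • bracketBilin x x = 0 := by
    rw [two_smul]
    nth_rewrite 1 [bracketBilin_swap x x]
    exact neg_add_cancel _
  exact (smul_eq_zero.mp h).resolve_left two_ne_zero

theorem bracketBilin_c_right (x : W22) : bracketBilin x c = 0 := by
  have h : bracketBilin.flip c = 0 := by
    refine basis.ext fun i => ?_
    simp only [LinearMap.flip_apply, c, bracketBilin_basis]
    cases i <;> rfl
  exact LinearMap.congr_fun h x

theorem bracketBilin_c_left (x : W22) : bracketBilin c x = 0 := by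
  rw [bracketBilin_swap x c, bracketBilin_c_right, neg_zero]

theorem bracketBilin_L_L (m n : ℤ) :
    bracketBilin (L m) (L n) = ((m : ℂ) - (n : ℂ)) • L (m + n) + centralTerm m n :=
  bracketBilin_basis _ _

theorem bracketBilin_L_H (m n : ℤ) :
    bracketBilin (L m) (H n) = ((m : ℂ) - (n : ℂ)) • H (m + n) + centralTerm m n :=
  bracketBilin_basis _ _

theorem bracketBilin_H_L (m n : ℤ) :
    bracketBilin (H m) (L n) = -(((n : ℂ) - (m : ℂ)) • H (n + m) + centralTerm n m) :=
  bracketBilin_basis _ _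

theorem bracketBilin_H_H (m n : ℤ) : bracketBilin (H m) (H n) = 0 :=
  bracketBilin_basis _ _

theorem bracketBilin_centralTerm_right (x : W22) (m n : ℤ) :
    bracketBilin x (centralTerm m n) = 0 := by
  unfold centralTerm
  split_ifs <;> simp [bracketBilin_c_right]

theorem bracketBilin_centralTerm_left (x : W22) (m n : ℤ) :
    bracketBilin (centralTerm m n) x = 0 := by
  rw [bracketBilin_swap x, bracketBilin_centralTerm_right, neg_zero]

theorem basis_L (m : ℤ) : basis (Gen.L m) = L m := rfl

theorem basis_H (m : ℤ) : basis (Gen.H m) = H m := rfl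

theorem basis_c : basis Gen.c = c := rfl

/-- The cocycle identity for the central term. -/
theorem centralTerm_cocycle (m n p : ℤ) :
    ((n : ℂ) - p) • centralTerm m (n + p) =
      -(((m : ℂ) - n) • centralTerm p (m + n)) + ((m : ℂ) - p) • centralTerm n (m + p) := by
  unfold centralTerm
  by_cases h : m + n + p = 0
  · obtain rfl : p = -m - n := by omega
    rw [if_pos (by ring), if_pos (by ring), if_pos (by ring)]
    simp only [smul_smul, ← add_smul, ← neg_smul]
    congr 1
    push_cast
    ring
  · rw [if_neg (by omega), if_neg (by omega), if_neg (by omega)]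
    simp

theorem bracketBilin_leibniz_basis (i j k : Gen) :
    bracketBilin (basis i) (bracketBilin (basis j) (basis k)) =
      bracketBilin (bracketBilin (basis i) (basis j)) (basis k) +
        bracketBilin (basis j) (bracketBilin (basis i) (basis k)) := by
  rcases i with m | m | _ <;> rcases j with n | n | _ <;> rcases k with p | p | _ <;>
    simp only [basis_L, basis_H, basis_c, bracketBilin_L_L, bracketBilin_L_H,
      bracketBilin_H_L, bracketBilin_H_H, bracketBilin_c_left, bracketBilin_c_right,
      map_add, map_neg, map_smul, map_zero, LinearMap.add_apply, LinearMap.neg_apply,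
      LinearMap.smul_apply, LinearMap.zero_apply, bracketBilin_centralTerm_left,
      bracketBilin_centralTerm_right, add_zero, neg_zero, smul_zero]
  all_goals
    have hc := centralTerm_cocycle m n p
    simp only [add_comm n m, add_comm p m, add_comm p n, show m + (n + p) = m + n + p by ring,
      show p + (m + n) = m + n + p by ring, show m + p + n = m + n + p by ring,
      show n + p + m = m + n + p by ring, show n + (m + p) = m + n + p by ring,
      centralTerm_swap p (m + n), centralTerm_swap n (m + p), centralTerm_swap m (n + p),
      Int.cast_add] at hc ⊢
    linear_combination (norm := module) hc

theorem bracketBilin_leibniz (x y z : W22) :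
    bracketBilin x (bracketBilin y z) =
      bracketBilin (bracketBilin x y) z + bracketBilin y (bracketBilin x z) := by
  have hz : ∀ i j z, bracketBilin (basis i) (bracketBilin (basis j) z) =
      bracketBilin (bracketBilin (basis i) (basis j)) z +
        bracketBilin (basis j) (bracketBilin (basis i) z) := fun i j z =>
    LinearMap.congr_fun (basis.ext fun k => bracketBilin_leibniz_basis i j k :
      bracketBilin (basis i) ∘ₗ bracketBilin (basis j) =
        bracketBilin (bracketBilin (basis i) (basis j)) +
          bracketBilin (basis j) ∘ₗ bracketBilin (basis i)) z
  have hy : ∀ i y z, bracketBilin (basis i) (bracketBilin y z) =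
      bracketBilin (bracketBilin (basis i) y) z +
        bracketBilin y (bracketBilin (basis i) z) := fun i y z =>
    LinearMap.congr_fun (basis.ext fun j => hz i j z :
      bracketBilin (basis i) ∘ₗ bracketBilin.flip z =
        bracketBilin.flip z ∘ₗ bracketBilin (basis i) +
          bracketBilin.flip (bracketBilin (basis i) z)) y
  exact LinearMap.congr_fun (basis.ext fun i => hy i y z :
    bracketBilin.flip (bracketBilin y z) =
      bracketBilin.flip z ∘ₗ bracketBilin.flip y +
        bracketBilin y ∘ₗ bracketBilin.flip z) x

instance instLieRing : LieRing W22 where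
  bracket x y := bracketBilin x y
  add_lie x y z := by simp only [map_add, LinearMap.add_apply]
  lie_add x y z := by simp only [map_add]
  lie_self x := bracketBilin_self x
  leibniz_lie x y z := bracketBilin_leibniz x y z

instance instLieAlgebra : LieAlgebra ℂ W22 where
  lie_smul t x y := (bracketBilin x).map_smul t y

theorem lie_L_L (m n : ℤ) : ⁅L m, L n⁆ = ((m : ℂ) - (n : ℂ)) • L (m + n) +
    (if m + n = 0 then (((m : ℂ) ^ 3 - (m : ℂ)) / 12) • c else 0) :=
  bracketBilin_L_L m n

theorem lie_L_H (m n : ℤ) : ⁅L m, H n⁆ = ((m : ℂ) - (n : ℂ)) • H (m + n) +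
    (if m + n = 0 then (((m : ℂ) ^ 3 - (m : ℂ)) / 12) • c else 0) :=
  bracketBilin_L_H m n

theorem lie_H_H (m n : ℤ) : ⁅H m, H n⁆ = 0 :=
  bracketBilin_H_H m n

theorem lie_c (x : W22) : ⁅x, c⁆ = 0 :=
  bracketBilin_c_right x

/-- The linear map `ω` with `ω (L_m) = H_m` and `ω (H_m) = ω (c) = 0`. -/
def omega : W22 →ₗ[ℂ] W22 :=
  basis.constr ℂ fun
    | Gen.L m => H m
    | Gen.H _ => 0
    | Gen.c => 0

theorem omega_L (m : ℤ) : omega (L m) = H m :=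
  basis.constr_basis ℂ _ (Gen.L m)

theorem omega_H (m : ℤ) : omega (H m) = 0 :=
  basis.constr_basis ℂ _ (Gen.H m)

theorem omega_c : omega c = 0 :=
  basis.constr_basis ℂ _ Gen.c

end

end W22

/-- A linear map `φ` on a Lie algebra is commuting if `[φ(x), x] = 0` for all `x`. -/
def IsLinearCommuting {R A : Type*} [CommRing R] [LieRing A] [LieAlgebra R A]
    (φ : A →ₗ[R] A) : Prop :=
  ∀ x : A, ⁅φ x, x⁆ = 0

/-! Polarizing `[φ x, x] = 0` gives `[φ x, y] = [x, φ y]`, so what `φ` does at a few elements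
controls it everywhere. Since `ad L_0` is diagonal in the basis, `φ L_0`, which commutes with `L_0`,
lies in the span of `L_0`, `H_0`, `c`. Its first two coordinates are the scalars `l`, `μ`;
subtracting `l • id + μ • ω`, itself commuting, leaves a commuting `ψ` with `ψ L_0` central. Testing
`ψ` against `L_0` and then `L_1` forces all its values into `ℂ c`, and their coefficient is `σ`. -/

namespace W22

/-- The weight of a basis element under the bracket with `L_0`. -/
def Gen.weight : Gen → ℤ
  | Gen.L m => m
  | Gen.H m => m
  | Gen.c => 0

theorem lie_H_L (m n : ℤ) : ⁅H m, L n⁆ = ((m : ℂ) - (n : ℂ)) • H (m + n) +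
    (if m + n = 0 then (((m : ℂ) ^ 3 - (m : ℂ)) / 12) • c else 0) := by
  have h : ⁅H m, L n⁆ = -(((n : ℂ) - (m : ℂ)) • H (n + m) + centralTerm n m) :=
    bracketBilin_H_L m n
  rw [h, centralTerm_swap m n, add_comm n m]
  unfold centralTerm
  module

theorem c_lie (x : W22) : ⁅c, x⁆ = 0 :=
  bracketBilin_c_left x

/-- The central term could only occur for `m = 0`, where `m³ - m` vanishes. -/
theorem lie_L_zero_basis (i : Gen) : ⁅basis i, L 0⁆ = (i.weight : ℂ) • basis i := by
  cases i with
  | L m =>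
    rw [basis_L, lie_L_L]
    by_cases h : m = 0 <;> simp [Gen.weight, h]
  | H m =>
    rw [basis_H, lie_H_L]
    by_cases h : m = 0 <;> simp [Gen.weight, h]
  | c => simp [basis_c, c_lie, Gen.weight]

theorem repr_lie_L_zero (x : W22) (i : Gen) :
    basis.repr ⁅x, L 0⁆ i = (i.weight : ℂ) * basis.repr x i := by
  have h : basis.coord i ∘ₗ bracketBilin.flip (L 0) = (i.weight : ℂ) • basis.coord i := by
    refine basis.ext fun j => ?_
    change basis.repr ⁅basis j, L 0⁆ i = (i.weight : ℂ) * basis.repr (basis j) i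
    rw [lie_L_zero_basis, map_smul, Finsupp.smul_apply, smul_eq_mul, Module.Basis.repr_self]
    by_cases hij : j = i
    · rw [hij]
    · simp [Finsupp.single_eq_of_ne' hij]
  exact LinearMap.congr_fun h x

/-- The centralizer of `L_0` is spanned by `L_0`, `H_0` and `c`. -/
theorem eq_of_lie_L_zero_eq_zero {x : W22} (hx : ⁅x, L 0⁆ = 0) :
    x = basis.coord (Gen.L 0) x • L 0 + basis.coord (Gen.H 0) x • H 0 +
      basis.coord Gen.c x • c := by
  refine basis.ext_elem fun i => ?_
  have h := repr_lie_L_zero x i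
  rw [hx, map_zero, Finsupp.zero_apply, eq_comm, mul_eq_zero, Int.cast_eq_zero] at h
  simp only [map_add, map_smul, Finsupp.add_apply, Finsupp.smul_apply, smul_eq_mul, L, H, c,
    Module.Basis.repr_self, Module.Basis.coord_apply]
  rcases i with m | m | _
  · by_cases hm : m = 0
    · subst hm; simp
    · have h0 := h.resolve_left hm
      simp [h0, Ne.symm hm]
  · by_cases hm : m = 0
    · subst hm; simp
    · have h0 := h.resolve_left hm
      simp [h0, Ne.symm hm]
  · simp

/-- The bracket is `-p L_1 - q H_1`, with no central term because `0 + 1 ≠ 0`. -/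
theorem eq_zero_of_lie_L_one_eq_zero {p q s : ℂ}
    (h : ⁅p • L 0 + q • H 0 + s • c, L 1⁆ = 0) : p = 0 ∧ q = 0 := by
  simp only [add_lie, smul_lie, lie_L_L, lie_H_L, c_lie] at h
  constructor
  · simpa [L, H] using DFunLike.congr_fun (congrArg basis.repr h) (Gen.L 1)
  · simpa [L, H] using DFunLike.congr_fun (congrArg basis.repr h) (Gen.H 1)

/-- The form `(x, y) ↦ [ω x, y]` is antisymmetric, hence alternating since 2 is invertible. On basis
vectors the only nontrivial case is `[H_m, L_n] = [L_m, H_n]`. -/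
theorem omega_lie_self (x : W22) : ⁅omega x, x⁆ = 0 := by
  have h : bracketBilin ∘ₗ omega = (bracketBilin ∘ₗ omega).flip.comp (-LinearMap.id) := by
    refine basis.ext fun i => basis.ext fun j => ?_
    change ⁅omega (basis i), basis j⁆ = ⁅omega (basis j), -basis i⁆
    rw [lie_neg]
    rcases i with m | m | _ <;> rcases j with n | n | _ <;>
      simp only [basis_L, basis_H, basis_c, omega_L, omega_H, omega_c, zero_lie, neg_zero,
        lie_c, lie_H_H]
    rw [lie_skew, lie_H_L, lie_L_H]
  have h1 : ⁅omega x, x⁆ = ⁅omega x, -x⁆ := LinearMap.congr_fun (LinearMap.congr_fun h x) x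
  rw [lie_neg] at h1
  have h2 : (2 : ℂ) • ⁅omega x, x⁆ = 0 := by rw [two_smul, add_eq_zero_iff_eq_neg]; exact h1
  exact (smul_eq_zero.mp h2).resolve_left two_ne_zero

end W22

/-- Polarization: expand the commuting condition at `x + y`. -/
theorem IsLinearCommuting.lie_apply {R A : Type*} [CommRing R] [LieRing A] [LieAlgebra R A]
    {φ : A →ₗ[R] A} (h : IsLinearCommuting φ) (x y : A) : ⁅φ x, y⁆ = ⁅x, φ y⁆ := by
  have hxy := h (x + y)
  rw [map_add, add_lie, lie_add, lie_add, h x, h y, zero_add, add_zero] at hxy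
  rw [eq_neg_of_add_eq_zero_left hxy, lie_skew]

namespace W22

theorem isLinearCommuting_of_eq {φ : W22 →ₗ[ℂ] W22} {l μ : ℂ} {σ : W22 →ₗ[ℂ] ℂ}
    (h : ∀ x, φ x = l • x + μ • omega x + σ x • c) : IsLinearCommuting φ := fun x => by
  simp [h x, add_lie, smul_lie, omega_lie_self, c_lie]

/-- A commuting map sending `L_0` into the centre takes all its values in the centre. -/
theorem apply_eq_smul_c {ψ : W22 →ₗ[ℂ] W22} (hψ : IsLinearCommuting ψ) {z : ℂ}
    (hz : ψ (L 0) = z • c) (x : W22) : ψ x = basis.coord Gen.c (ψ x) • c := by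
  -- `[ψ y, L_0] = [y, ψ L_0] = 0` as `ψ L_0` is central.
  have hspan (y : W22) := eq_of_lie_L_zero_eq_zero (x := ψ y) <| by
    rw [hψ.lie_apply, hz, lie_smul, lie_c, smul_zero]
  have hcentral (y : W22) (hy : ⁅ψ y, L 1⁆ = 0) : ψ y = basis.coord Gen.c (ψ y) • c := by
    have hs := hspan y
    rw [hs] at hy
    obtain ⟨hp, hq⟩ := eq_zero_of_lie_L_one_eq_zero hy
    rwa [hp, hq, zero_smul, zero_smul, zero_add, zero_add] at hs
  refine hcentral x ?_
  -- `ψ L_1` commutes with `L_1`, so it is central; then `[ψ x, L_1] = [x, ψ L_1] = 0` for every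
  -- `x`.
  rw [hψ.lie_apply, hcentral (L 1) (hψ (L 1)), lie_smul, lie_c, smul_zero]

end W22

theorem mainTheorem3 (φ : W22 →ₗ[ℂ] W22) :
    IsLinearCommuting φ ↔
      ∃ (l μ : ℂ) (σ : W22 →ₗ[ℂ] ℂ),
        ∀ x : W22, φ x = l • x + μ • W22.omega x + σ x • W22.c := by
  refine ⟨fun hφ => ?_, fun ⟨l, μ, σ, h⟩ => W22.isLinearCommuting_of_eq h⟩
  have h0 := W22.eq_of_lie_L_zero_eq_zero (hφ (W22.L 0))
  set l := W22.basis.coord (W22.Gen.L 0) (φ (W22.L 0))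
  set μ := W22.basis.coord (W22.Gen.H 0) (φ (W22.L 0))
  set z := W22.basis.coord W22.Gen.c (φ (W22.L 0))
  let ψ : W22 →ₗ[ℂ] W22 := φ - l • LinearMap.id - μ • W22.omega
  have hψx (x : W22) : ψ x = φ x - l • x - μ • W22.omega x := rfl
  have hψ : IsLinearCommuting ψ := fun x => by
    rw [hψx, sub_lie, sub_lie, smul_lie, smul_lie, hφ x, W22.omega_lie_self, lie_self]
    simp
  have hz : ψ (W22.L 0) = z • W22.c := by
    rw [hψx, W22.omega_L, h0]
    abel
  refine ⟨l, μ, W22.basis.coord W22.Gen.c ∘ₗ ψ, fun x => ?_⟩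
  rw [LinearMap.comp_apply, ← W22.apply_eq_smul_c hψ hz x, hψx]
  abel
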